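/- For every natural number $n$ there exists a constant $C$, depending only on $n$, with the following property. Let $M$ be a subgroup of $\mathrm{GL}_n(\mathbb{C})$ which contains a normal subgroup $\Gamma \trianglelefteq M$ of finite index such that $\Gamma \cong \mathbb{Z}$. Denote by $c_M$ the smallest of the indices $[M/\Gamma : A]$ of the abelian subgroups $A$ of the finite group $M/\Gamma$. Then $c_M < C$. -/

import Mathlib

/-! Conjugation on `Γ ≅ ℤ` has only the automorphisms `±1`, so the centralizer `Z` of `Γ` has index
at most 2. Let `γ` generate `Γ`, let `d = [Z : Γ]`, and let `s` be a `d`-th root of `γ` commuting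
with `Z`. The transfer `h : Z → ℤ` sends `γ` to `d`, so `g ↦ g * s ^ (-h g)` is a homomorphism that
kills `Γ`; its image is a finite linear group. Jordan's theorem gives an abelian subgroup of bounded
index there, and its preimage in `Z` is abelian because `s` commutes with everything in sight.
Jordan's theorem follows from a norm argument: in a finite group of contractions, elements at
distance less than 1/2 from 1 commute, and cosets of the subgroup they generate are separated, so a
packing bound limits their number. -/

/-- The mean of the first `N` powers of `u`; an idempotent when `u ^ N = 1`. -/
noncomputable def powMean {A : Type*} [Ring A] [Algebra ℂ A] (N : ℕ) (u : A) : A :=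
  (N : ℂ)⁻¹ • ∑ k ∈ Finset.range N, u ^ k

/-! ### Spectral idempotents of elements of finite order. -/

section PowMean

variable {A : Type*} [Ring A] [Algebra ℂ A]

theorem mul_powMean {N : ℕ} {u : A} (hu : u ^ N = 1) : u * powMean N u = powMean N u := by
  unfold powMean
  rw [mul_smul_comm, Finset.mul_sum]
  congr 1
  have h1 := Finset.sum_range_succ (fun k => u ^ k) N
  have h2 := Finset.sum_range_succ' (fun k => u ^ k) N
  rw [h1, hu, pow_zero] at h2
  simpa [pow_succ'] using (add_right_cancel h2).symm

theorem pow_mul_powMean {N : ℕ} {u : A} (hu : u ^ N = 1) (k : ℕ) :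
    u ^ k * powMean N u = powMean N u := by
  induction k with
  | zero => simp
  | succ k ih => rw [pow_succ, mul_assoc, mul_powMean hu, ih]

theorem powMean_isIdempotentElem {N : ℕ} (hN : N ≠ 0) {u : A} (hu : u ^ N = 1) :
    IsIdempotentElem (powMean N u) := by
  have hN' : (N : ℂ) ≠ 0 := by exact_mod_cast hN
  have h : (∑ k ∈ Finset.range N, u ^ k) * powMean N u = (N : ℂ) • powMean N u := by
    rw [Finset.sum_mul, Finset.sum_congr rfl fun k _ => pow_mul_powMean hu k]
    simp [Nat.cast_smul_eq_nsmul]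
  change ((N : ℂ)⁻¹ • ∑ k ∈ Finset.range N, u ^ k) * powMean N u = powMean N u
  rw [smul_mul_assoc, h, smul_smul, inv_mul_cancel₀ hN', one_smul]

theorem Commute.powMean_powMean {N : ℕ} {u v : A} (h : Commute u v) :
    Commute (powMean N u) (powMean N v) := by
  unfold powMean
  refine Commute.smul_right (Commute.smul_left ?_ _) _
  exact Commute.sum_left _ _ _ fun i _ => Commute.sum_right _ _ _ fun j _ => h.pow_pow i j

theorem sum_powMean {N : ℕ} (hN : N ≠ 0) {ζ : ℂ} (hζ : IsPrimitiveRoot ζ N) (x : A) :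
    ∑ j ∈ Finset.range N, powMean N (ζ ^ j • x) = 1 := by
  have hN' : (N : ℂ) ≠ 0 := by exact_mod_cast hN
  unfold powMean
  rw [← Finset.smul_sum, Finset.sum_comm]
  have h : ∀ k ∈ Finset.range N, ∑ j ∈ Finset.range N, (ζ ^ j • x) ^ k =
      if k = 0 then (N : ℂ) • (1 : A) else 0 := by
    intro k hk
    split_ifs with h0
    · simp [h0, Nat.cast_smul_eq_nsmul]
    · have h1 : ζ ^ k ≠ 1 := hζ.pow_ne_one_of_pos_of_lt h0 (Finset.mem_range.1 hk)
      have h2 : ∑ j ∈ Finset.range N, (ζ ^ k) ^ j = 0 := by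
        have := geom_sum_mul (ζ ^ k) N
        rw [← pow_mul, mul_comm k, pow_mul, hζ.pow_eq_one, one_pow, sub_self] at this
        exact (mul_eq_zero.1 this).resolve_right (sub_ne_zero.2 h1)
      simp_rw [smul_pow, ← Finset.sum_smul, ← pow_mul]
      simp_rw [← pow_mul, mul_comm k] at h2
      rw [h2, zero_smul]
  rw [Finset.sum_congr rfl h, Finset.sum_ite_eq' , if_pos (Finset.mem_range.2 (Nat.pos_of_ne_zero hN)),
    smul_smul, inv_mul_cancel₀ hN', one_smul]

/-- `powMean N (ζ • x)` is the spectral projection of `x` for the eigenvalue `ζ⁻¹`, and `x` is a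
linear combination of these. -/
theorem commute_of_forall_commute_powMean {N : ℕ} (hN : N ≠ 0) {x y : A} (hx : x ^ N = 1)
    (h : ∀ ζ : ℂ, ζ ^ N = 1 → Commute (powMean N (ζ • x)) y) : Commute x y := by
  have hζ := Complex.isPrimitiveRoot_exp N hN
  set ζ := Complex.exp (2 * Real.pi * Complex.I / N)
  have h0 : ζ ≠ 0 := hζ.ne_zero hN
  have hj : ∀ j : ℕ, (ζ ^ j) ^ N = 1 := fun j => by
    rw [← pow_mul, mul_comm, pow_mul, hζ.pow_eq_one, one_pow]
  have hx' : x = ∑ j ∈ Finset.range N, (ζ ^ j)⁻¹ • powMean N (ζ ^ j • x) := by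
    conv_lhs => rw [← mul_one x, ← sum_powMean hN hζ x, Finset.mul_sum]
    refine Finset.sum_congr rfl fun j _ => ?_
    have h1 : (ζ ^ j • x) ^ N = 1 := by rw [smul_pow, hj, hx, one_smul]
    rw [eq_inv_smul_iff₀ (pow_ne_zero j h0), ← smul_mul_assoc, mul_powMean h1]
  rw [hx']
  exact Commute.sum_left _ _ _ fun j _ => (h _ (hj j)).smul_left _

end PowMean

theorem norm_powMean_le_one {A : Type*} [NormedRing A] [NormedAlgebra ℂ A] {N : ℕ} {u : A}
    (hu : ∀ k, ‖u ^ k‖ ≤ 1) : ‖powMean N u‖ ≤ 1 := by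
  unfold powMean
  rw [norm_smul, norm_inv, Complex.norm_natCast]
  rcases eq_or_ne N 0 with rfl | hN
  · simp
  have hN' : (0 : ℝ) < N := by exact_mod_cast Nat.pos_of_ne_zero hN
  rw [inv_mul_le_iff₀ hN', mul_one]
  refine (norm_sum_le _ _).trans ?_
  simpa using Finset.sum_le_sum fun k (_ : k ∈ Finset.range N) => hu k

/-- Commuting idempotents satisfy `(p - q) ^ 3 = p - q`, which forces the norm of `p - q` to be 0 or
at least 1. -/
theorem IsIdempotentElem.eq_of_commute_of_norm_sub_lt_one {A : Type*} [NormedRing A] {p q : A}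
    (hp : IsIdempotentElem p) (hq : IsIdempotentElem q) (h : Commute p q) (hpq : ‖p - q‖ < 1) :
    p = q := by
  have hp' : p * p = p := hp
  have hq' : q * q = q := hq
  have h' : p * q = q * p := h
  have h3 : (p - q) * ((p - q) * (p - q)) = p - q := by
    have e1 : p * (q * p) = q * p := by rw [← h', ← mul_assoc, hp']
    have e2 : q * (q * p) = q * p := by rw [← mul_assoc, hq']
    have : (p - q) * (p - q) = p + q - q * p - q * p := by
      rw [mul_sub, sub_mul, sub_mul, hp', hq', h']; abel
    rw [this]
    simp only [mul_sub, sub_mul, mul_add, hp', hq', h', e1, e2]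
    abel
  have hn : ‖p - q‖ ≤ ‖p - q‖ * (‖p - q‖ * ‖p - q‖) := by
    conv_lhs => rw [← h3]
    exact (norm_mul_le _ _).trans (by gcongr; exact norm_mul_le _ _)
  have h0 := norm_nonneg (p - q)
  rw [← sub_eq_zero, ← norm_eq_zero]
  nlinarith [mul_nonneg h0 h0]

theorem commute_map_inv_left {G A : Type*} [Group G] [Monoid A] {ρ : G →* A} {g h : G}
    (hgh : Commute (ρ g) (ρ h)) : Commute (ρ g⁻¹) (ρ h) := by
  have := congrArg (fun z => ρ g⁻¹ * z * ρ g⁻¹) hgh.eq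
  simp only [← map_mul] at this
  change _ * _ = _ * _
  rw [← map_mul, ← map_mul]
  convert this.symm using 2 <;> group

/-! ### Jordan's theorem for contractions. -/

section Contractive

variable {G A : Type*} [Group G] [NormedRing A] [NormedAlgebra ℂ A] {ρ : G →* A}

omit [NormedAlgebra ℂ A] in
theorem norm_map_sub_map_inv_mul (hρ : ∀ g, ‖ρ g‖ ≤ 1) (g h : G) :
    ‖ρ (g⁻¹ * h) - 1‖ ≤ ‖ρ g - ρ h‖ := by
  have : ρ (g⁻¹ * h) - 1 = ρ g⁻¹ * (ρ h - ρ g) := by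
    rw [mul_sub, ← map_mul, ← map_mul, inv_mul_cancel, map_one]
  rw [this, norm_sub_rev (ρ g)]
  exact (norm_mul_le _ _).trans (mul_le_of_le_one_left (norm_nonneg _) (hρ _))

/-- Each spectral projection `p` of `ρ a` commutes with its conjugate `q` by `ρ b`, and `‖p - q‖ ≤ 2
* ‖ρ b - 1‖ < 1`. Hence `p = q`, so `ρ b` commutes with every `p`. -/
theorem commute_map_of_commute_map_conj [Finite G] (hρ : ∀ g, ‖ρ g‖ ≤ 1) {a b : G}
    (hb : ‖ρ b - 1‖ < 1 / 2) (h : Commute (ρ a) (ρ (b * a * b⁻¹))) : Commute (ρ a) (ρ b) := by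
  have hN : Nat.card G ≠ 0 := Nat.card_pos.ne'
  set N := Nat.card G
  have hpow : ∀ g : G, ρ g ^ N = 1 := fun g => by rw [← map_pow, pow_card_eq_one', map_one]
  have hbb : ρ b * ρ b⁻¹ = 1 := by rw [← map_mul, mul_inv_cancel, map_one]
  have hbb' : ρ b⁻¹ * ρ b = 1 := by rw [← map_mul, inv_mul_cancel, map_one]
  refine commute_of_forall_commute_powMean hN (hpow a) fun ζ hζ => ?_
  have hζ1 : ‖ζ‖ = 1 := Complex.norm_eq_one_of_pow_eq_one hζ hN
  have hun : ∀ g : G, (ζ • ρ g) ^ N = 1 := fun g => by rw [smul_pow, hζ, hpow, one_smul]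
  have hu : ∀ g : G, ∀ k, ‖(ζ • ρ g) ^ k‖ ≤ 1 := fun g k => by
    rw [smul_pow, norm_smul, norm_pow, hζ1, one_pow, one_mul, ← map_pow]
    exact hρ _
  set p := powMean N (ζ • ρ a)
  set q := powMean N (ζ • ρ (b * a * b⁻¹))
  have hqp : q = ρ b * p * ρ b⁻¹ := by
    simp only [p, q, powMean, mul_smul_comm, smul_mul_assoc, Finset.mul_sum, Finset.sum_mul,
      smul_pow, ← map_pow, ← map_mul, conj_pow]
  have hcomm : Commute p q := Commute.powMean_powMean ((h.smul_left _).smul_right _)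
  have hnorm : ‖p - q‖ < 1 := by
    have e : p - q = (p * (ρ b - 1) - (ρ b - 1) * p) * ρ b⁻¹ := by
      rw [hqp, mul_sub, sub_mul (ρ b), mul_one, one_mul, sub_sub_sub_cancel_right, sub_mul,
        mul_assoc p, hbb, mul_one]
    have h1 : ‖p‖ ≤ 1 := norm_powMean_le_one (hu a)
    have h2 : ‖p * (ρ b - 1)‖ ≤ ‖ρ b - 1‖ :=
      (norm_mul_le _ _).trans (mul_le_of_le_one_left (norm_nonneg _) h1)
    have h3 : ‖(ρ b - 1) * p‖ ≤ ‖ρ b - 1‖ :=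
      (norm_mul_le _ _).trans (mul_le_of_le_one_right (norm_nonneg _) h1)
    have h4 := norm_sub_le (p * (ρ b - 1)) ((ρ b - 1) * p)
    rw [e]
    refine ((norm_mul_le _ _).trans (mul_le_of_le_one_right (norm_nonneg _) (hρ _))).trans_lt ?_
    linarith
  have hpq : p = q := (powMean_isIdempotentElem hN (hun _)).eq_of_commute_of_norm_sub_lt_one
    (powMean_isIdempotentElem hN (hun _)) hcomm hnorm
  change p * ρ b = ρ b * p
  conv_lhs => rw [hpq, hqp, mul_assoc, hbb', mul_one]

omit [NormedAlgebra ℂ A] in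
theorem norm_map_commutator_sub_one_le (hρ : ∀ g, ‖ρ g‖ ≤ 1) (a b : G) :
    ‖ρ (a * b * a⁻¹ * b⁻¹) - 1‖ ≤ 2 * ‖ρ a - 1‖ * ‖ρ b - 1‖ := by
  have e : ρ (a * b * a⁻¹ * b⁻¹) - 1 =
      ((ρ a - 1) * (ρ b - 1) - (ρ b - 1) * (ρ a - 1)) * ρ (a⁻¹ * b⁻¹) := by
    have : ρ b * ρ a * ρ (a⁻¹ * b⁻¹) = 1 := by
      rw [← map_mul, ← map_mul, ← map_one ρ]; congr 1; group
    have e2 : (ρ a - 1) * (ρ b - 1) - (ρ b - 1) * (ρ a - 1) = ρ a * ρ b - ρ b * ρ a := by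
      noncomm_ring
    rw [e2, sub_mul, this, ← map_mul, ← map_mul]; congr 2; group
  rw [e]
  refine (norm_mul_le _ _).trans ((mul_le_of_le_one_right (norm_nonneg _) (hρ _)).trans ?_)
  refine (norm_sub_le _ _).trans ?_
  have h1 := norm_mul_le (ρ a - 1) (ρ b - 1)
  have h2 := norm_mul_le (ρ b - 1) (ρ a - 1)
  linarith

/-- Among the counterexamples `c` for `a`, take one closest to 1. The commutator of `a` and `c` is
strictly closer, so it commutes with `a`; then so does the conjugate of `a` by `c`, and the previous
criterion applies. -/
theorem commute_map_of_norm_sub_one_lt [Finite G] (hρ : ∀ g, ‖ρ g‖ ≤ 1) {a b : G}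
    (ha : ‖ρ a - 1‖ < 1 / 2) (hb : ‖ρ b - 1‖ < 1 / 2) : Commute (ρ a) (ρ b) := by
  by_contra hab
  obtain ⟨c, ⟨hc, hac⟩, hmin⟩ := Set.exists_min_image
    {c : G | ‖ρ c - 1‖ < 1 / 2 ∧ ¬ Commute (ρ a) (ρ c)} (fun c => ‖ρ c - 1‖) (Set.toFinite _)
    ⟨b, hb, hab⟩
  have hpos : 0 < ‖ρ c - 1‖ := norm_pos_iff.2 fun h0 => hac (by
    rw [sub_eq_zero.1 h0]; exact Commute.one_right _)
  have hlt : ‖ρ (a * c * a⁻¹ * c⁻¹) - 1‖ < ‖ρ c - 1‖ :=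
    (norm_map_commutator_sub_one_le hρ a c).trans_lt (by nlinarith)
  have hcomm : Commute (ρ a) (ρ (a * c * a⁻¹ * c⁻¹)) := by
    by_contra h
    exact absurd (hmin _ ⟨hlt.trans hc, h⟩) (not_le.2 hlt)
  have hinv : Commute (ρ a) (ρ a⁻¹) := (commute_map_inv_left (Commute.refl (ρ a))).symm
  have h1 : Commute (ρ a) (ρ (c * a⁻¹ * c⁻¹)) := by
    have : c * a⁻¹ * c⁻¹ = a⁻¹ * (a * c * a⁻¹ * c⁻¹) := by group
    rw [this, map_mul]
    exact hinv.mul_right hcomm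
  have h2 : Commute (ρ a) (ρ (c * a * c⁻¹)) := by
    have := (commute_map_inv_left h1.symm).symm
    have e : (c * a⁻¹ * c⁻¹)⁻¹ = c * a * c⁻¹ := by group
    rwa [e] at this
  exact hac (commute_map_of_commute_map_conj hρ hc h2)

/-- **Jordan's theorem** for a finite group of contractions in a finite-dimensional algebra. -/
theorem exists_subgroup_commute_index_le_of_norm_le_one [Finite G] [FiniteDimensional ℝ A]
    (hρ : ∀ g, ‖ρ g‖ ≤ 1) : ∃ H : Subgroup G, (∀ a ∈ H, ∀ b ∈ H, Commute (ρ a) (ρ b)) ∧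
      H.index ≤ 5 ^ Module.finrank ℝ A := by
  classical
  refine ⟨Subgroup.closure {g | ‖ρ g - 1‖ < 1 / 2}, fun a ha b hb => ?_, ?_⟩
  · induction ha, hb using Subgroup.closure_induction₂ with
    | mem x y hx hy => exact commute_map_of_norm_sub_one_lt hρ hx hy
    | one_left => rw [map_one]; exact Commute.one_left _
    | one_right => rw [map_one]; exact Commute.one_right _
    | mul_left x y z _ _ _ h1 h2 => rw [map_mul]; exact h1.mul_left h2
    | mul_right x y z _ _ _ h1 h2 => rw [map_mul]; exact h1.mul_right h2
    | inv_left x y _ _ h => exact commute_map_inv_left h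
    | inv_right x y _ _ h => exact (commute_map_inv_left h.symm).symm
  · set H := Subgroup.closure {g | ‖ρ g - 1‖ < 1 / 2}
    have : Fintype (G ⧸ H) := Fintype.ofFinite _
    -- Doubling turns 1/2-separated points of the unit ball into 1-separated points of the ball of
    -- radius 2, the normalization of the packing bound `5 ^ dim`.
    have hsep : ∀ x y : G ⧸ H, x ≠ y → 1 ≤ ‖2 • ρ x.out - 2 • ρ y.out‖ := fun x y hxy => by
      have hn : (x.out)⁻¹ * y.out ∉ H := fun hm => hxy (by
        rw [← QuotientGroup.eq] at hm
        simpa using hm)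
      have h1 : 1 / 2 ≤ ‖ρ ((x.out)⁻¹ * y.out) - 1‖ :=
        not_lt.1 fun h => hn (Subgroup.subset_closure h)
      have h2 := norm_map_sub_map_inv_mul hρ x.out y.out
      rw [← smul_sub, ← Nat.cast_smul_eq_nsmul ℝ, norm_smul]
      norm_num
      linarith
    have hinj : Function.Injective fun x : G ⧸ H => 2 • ρ x.out := fun x y hxy => by
      by_contra hne
      have := hsep x y hne
      simp only at hxy
      rw [hxy, sub_self, norm_zero] at this
      linarith
    have hcard := Besicovitch.card_le_of_separated
      (Finset.univ.image fun x : G ⧸ H => 2 • ρ x.out)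
      (by
        intro c hc
        obtain ⟨x, -, rfl⟩ := Finset.mem_image.1 hc
        rw [← Nat.cast_smul_eq_nsmul ℝ, norm_smul]
        norm_num
        linarith [hρ x.out])
      (by
        intro c hc d hd hcd
        obtain ⟨x, -, rfl⟩ := Finset.mem_image.1 hc
        obtain ⟨y, -, rfl⟩ := Finset.mem_image.1 hd
        exact hsep x y fun h => hcd (by rw [h]))
    rwa [Finset.card_image_of_injective _ hinj, Finset.card_univ, ← Nat.card_eq_fintype_card] at hcard

end Contractive

/-! ### Jordan's theorem for finite linear groups. -/

theorem exists_subgroup_commute_index_le_of_norm_le {G V W : Type*} [Group G] [Finite G]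
    [AddCommGroup V] [Module ℂ V] [NormedAddCommGroup W] [NormedSpace ℂ W] [FiniteDimensional ℂ W]
    (r : G →* Module.End ℂ V) (e : V ≃ₗ[ℂ] W) (hr : ∀ g v, ‖e (r g v)‖ ≤ ‖e v‖) :
    ∃ H : Subgroup G, (∀ a ∈ H, ∀ b ∈ H, Commute (r a) (r b)) ∧
      H.index ≤ 5 ^ (2 * Module.finrank ℂ V ^ 2) := by
  let f : Module.End ℂ V ≃* (W →L[ℂ] W) :=
    (e.conjRingEquiv).toMulEquiv.trans (Module.End.toContinuousLinearMap W).toMulEquiv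
  let ρ : G →* (W →L[ℂ] W) := f.toMonoidHom.comp r
  have hρ : ∀ g, ‖ρ g‖ ≤ 1 := fun g => by
    refine ContinuousLinearMap.opNorm_le_bound _ zero_le_one fun w => ?_
    obtain ⟨v, rfl⟩ := e.surjective w
    have h1 : ρ g (e v) = e (r g v) := by
      change e (r g (e.symm (e v))) = _
      rw [e.symm_apply_apply]
    rw [h1, one_mul]
    exact hr g v
  have hdim : Module.finrank ℝ (W →L[ℂ] W) = 2 * Module.finrank ℂ V ^ 2 := by
    have h1 : Module.finrank ℂ (W →L[ℂ] W) = Module.finrank ℂ V ^ 2 := by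
      rw [← (LinearMap.toContinuousLinearMap (𝕜 := ℂ) (E := W) (F' := W)).finrank_eq,
        Module.finrank_linearMap, ← e.finrank_eq, sq]
    rw [finrank_real_of_complex, h1]
  have : FiniteDimensional ℝ (W →L[ℂ] W) := FiniteDimensional.complexToReal _
  obtain ⟨H, hH, hi⟩ := exists_subgroup_commute_index_le_of_norm_le_one hρ
  refine ⟨H, fun a ha b hb => f.injective ?_, hdim ▸ hi⟩
  rw [map_mul, map_mul]
  exact hH a ha b hb

/-- **Jordan's theorem** on finite linear groups. -/
theorem exists_subgroup_commute_index_le_of_finite {G : Type*} [Group G] [Finite G] {n : ℕ}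
    (r : G →* Module.End ℂ (Fin n → ℂ)) : ∃ H : Subgroup G,
      (∀ a ∈ H, ∀ b ∈ H, Commute (r a) (r b)) ∧ H.index ≤ 5 ^ (2 * n ^ 2) := by
  have := Fintype.ofFinite G
  -- The orbit map pulls back the sup norm to an invariant norm: `r g` merely permutes the
  -- coordinates indexed by `G`.
  let ι : (Fin n → ℂ) →ₗ[ℂ] (G → Fin n → ℂ) := LinearMap.pi r
  have hι : Function.Injective ι := fun v w h => by simpa [ι] using congrFun h 1
  obtain ⟨H, hH, hi⟩ :=
    exists_subgroup_commute_index_le_of_norm_le r (LinearEquiv.ofInjective ι hι) fun g v => by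
      change ‖ι (r g v)‖ ≤ ‖ι v‖
      refine (pi_norm_le_iff_of_nonneg (norm_nonneg _)).2 fun h => ?_
      have h2 : ι (r g v) h = ι v (h * g) := by simp [ι]
      rw [h2]
      exact norm_le_pi_norm _ _
  exact ⟨H, hH, by simpa using hi⟩

/-! ### Roots of invertible matrices. -/

/-- An invertible complex matrix has a `d`-th root commuting with its commutant. -/
theorem exists_pow_eq_forall_commute {ι : Type*} [Fintype ι] [DecidableEq ι]
    (g : (Matrix ι ι ℂ)ˣ) {d : ℕ} (hd : d ≠ 0) :
    ∃ s : (Matrix ι ι ℂ)ˣ, s ^ d = g ∧ ∀ h, Commute h g → Commute h s := by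
  open Polynomial in
  classical
  set x : Matrix ι ι ℂ := g.val
  set χ := x.charpoly
  have hχ : χ ≠ 0 := x.charpoly_monic.ne_zero
  choose root hroot using fun z : ℂ => IsAlgClosed.exists_pow_nat_eq z (Nat.pos_of_ne_zero hd)
  -- `p` takes a `d`-th root at each eigenvalue, so `p ^ d - X` vanishes there and is nilpotent
  -- modulo `χ`.
  set p : ℂ[X] := Lagrange.interpolate χ.roots.toFinset id root
  have hp : χ ∣ (p ^ d - X) ^ Multiset.card χ.roots := by
    have hs : (χ.roots.map fun a => X - C a).prod = χ := by
      exact (IsAlgClosed.splits χ).eq_prod_roots_of_monic x.charpoly_monic |>.symm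
    conv_lhs => rw [← hs]
    have : (p ^ d - X) ^ Multiset.card χ.roots = (χ.roots.map fun _ => p ^ d - X).prod := by simp
    rw [this]
    refine Multiset.prod_dvd_prod_of_dvd _ _ fun a ha => ?_
    rw [dvd_iff_isRoot, IsRoot, eval_sub, eval_pow, eval_X]
    have := Lagrange.eval_interpolate_at_node root (s := χ.roots.toFinset) (v := id)
      Function.injective_id.injOn (Multiset.mem_toFinset.2 ha)
    rw [id] at this
    rw [this, hroot, sub_self]
  have hnil : IsNilpotent (AdjoinRoot.mk χ p ^ d - AdjoinRoot.root χ) := by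
    refine ⟨Multiset.card χ.roots, ?_⟩
    simpa using AdjoinRoot.mk_eq_zero.2 hp
  have hroot_unit : IsUnit (AdjoinRoot.root χ) := by
    have h0 : ¬ X ∣ χ := by
      rw [X_dvd_iff]
      intro h0
      have hdet := x.det_eq_sign_charpoly_coeff
      rw [show x.charpoly.coeff 0 = 0 from h0, mul_zero] at hdet
      have := (Matrix.isUnit_iff_isUnit_det x).1 g.isUnit
      rw [hdet] at this
      exact not_isUnit_zero this
    obtain ⟨u, v, huv⟩ := irreducible_X.coprime_iff_not_dvd.2 h0
    refine isUnit_iff_exists_inv'.2 ⟨AdjoinRoot.mk χ u, ?_⟩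
    simpa using congrArg (AdjoinRoot.mk χ) huv
  have hp_unit : IsUnit (AdjoinRoot.mk χ p) := by
    refine (isUnit_pow_iff hd).1 ?_
    rw [← sub_add_cancel (AdjoinRoot.mk χ p ^ d) (AdjoinRoot.root χ)]
    exact hnil.isUnit_add_right_of_commute hroot_unit (Commute.all _ _)
  have hd_unit : IsUnit (d : AdjoinRoot χ) := by
    have : (d : AdjoinRoot χ) = algebraMap ℂ (AdjoinRoot χ) d := by simp
    rw [this]
    exact (IsUnit.mk0 (d : ℂ) (by exact_mod_cast hd)).map _
  -- Newton iteration corrects `p` to an exact root modulo `χ`, since the derivative `d * p ^ (d -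
  -- 1)` is a unit. The root is a polynomial in the matrix, hence commutes with its commutant.
  obtain ⟨t, ⟨-, ht⟩, -⟩ := existsUnique_nilpotent_sub_and_aeval_eq_zero
    (P := X ^ d - C (AdjoinRoot.root χ)) (x := AdjoinRoot.mk χ p) (by simpa using hnil)
    (by
      rw [derivative_sub, derivative_X_pow, derivative_C, sub_zero]
      simpa using ⟨hd_unit, hp_unit.pow (d - 1)⟩)
  obtain ⟨q, rfl⟩ := AdjoinRoot.mk_surjective t
  have ht' : AdjoinRoot.mk χ (q ^ d - X) = 0 := by simpa using ht
  obtain ⟨w, hw⟩ := AdjoinRoot.mk_eq_zero.1 ht'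
  have hq : aeval x q ^ d = x := by
    have := congrArg (aeval x) hw
    rw [map_mul, x.aeval_self_charpoly, zero_mul, map_sub, map_pow, aeval_X, sub_eq_zero] at this
    exact this
  have hq_unit : IsUnit (aeval x q) := (isUnit_pow_iff hd).1 (by rw [hq]; exact g.isUnit)
  refine ⟨hq_unit.unit, Units.ext (by simpa using hq), fun h hh => ?_⟩
  have hh' : Commute (h : Matrix ι ι ℂ) x := hh.map (Units.coeHom _)
  have : Commute (h : Matrix ι ι ℂ) (aeval x q) := by
    rw [aeval_eq_sum_range]
    exact Commute.sum_right _ _ _ fun k _ => (hh'.pow_right k).smul_right _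
  exact Units.ext this

/-! ### Groups with an infinite cyclic subgroup of finite index. -/

open Subgroup

theorem exists_isMulCommutative_index_le_of_le_center {n : ℕ} {M : Type*} [Group M]
    (ι : M →* Matrix.GeneralLinearGroup (Fin n) ℂ) (hι : Function.Injective ι)
    (Γ : Subgroup M) [Γ.FiniteIndex] (hΓ : Γ ≤ center M) (e : Γ ≃* Multiplicative ℤ) :
    ∃ A : Subgroup M, IsMulCommutative A ∧ A.index ≤ 5 ^ (2 * n ^ 2) ∧ A.index ≠ 0 := by
  obtain ⟨s, hs, hs'⟩ := exists_pow_eq_forall_commute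
    (ι (e.symm (Multiplicative.ofAdd 1))) Γ.index_ne_zero_of_finite
  have hcomm : ∀ g, Commute (ι g) s := fun g => hs' _ <| by
    have h := (mem_center_iff.1 (hΓ (e.symm (Multiplicative.ofAdd 1)).2) g)
    exact Commute.map (f := ι) h
  let h : M →* Multiplicative ℤ := MonoidHom.transfer (H := Γ) e.toMonoidHom
  -- Since `Γ` is central, the transfer restricted to it is the power map with exponent the index;
  -- this is why `s` was taken as a root of that order.
  have hkey : ∀ x : Γ, h x = e x ^ Γ.index := fun x => by
    have hx : ∀ (k : ℕ) (g₀ : M), g₀⁻¹ * (x : M) ^ k * g₀ = (x : M) ^ k := fun k g₀ => by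
      rw [mul_assoc, ← mem_center_iff.1 (pow_mem (hΓ x.2) k) g₀, inv_mul_cancel_left]
    have := MonoidHom.transfer_eq_pow (H := Γ) e.toMonoidHom (x : M) fun k g₀ _ => hx k g₀
    refine this.trans ?_
    rw [← map_pow]
    rfl
  let φ : M →* Matrix.GeneralLinearGroup (Fin n) ℂ :=
    { toFun := fun g => ι g * s ^ (-(h g).toAdd)
      map_one' := by simp
      map_mul' := fun a b => by
        rw [map_mul, map_mul, toAdd_mul, neg_add, zpow_add, mul_assoc, mul_assoc,
          ← mul_assoc (ι b), ((hcomm b).zpow_right _).eq]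
        simp only [mul_assoc] }
  have hφ : ∀ g, ι g = φ g * s ^ (h g).toAdd := fun g => by simp [φ]
  have hφs : ∀ g, Commute (φ g) s := fun g =>
    (hcomm g).mul_left ((Commute.refl s).zpow_left _)
  have hker : Γ ≤ φ.ker := fun x hx => by
    have hx' : ι x = s ^ (h x).toAdd := by
      have e1 : (⟨x, hx⟩ : Γ) = e.symm (Multiplicative.ofAdd 1) ^ (e ⟨x, hx⟩).toAdd := by
        rw [← map_zpow, ← Int.ofAdd_mul, one_mul, ofAdd_toAdd, e.symm_apply_apply]
      have e2 : x = (e.symm (Multiplicative.ofAdd 1) : M) ^ (e ⟨x, hx⟩).toAdd := by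
        have := congrArg Subtype.val e1
        rwa [coe_zpow] at this
      have e3 := hkey ⟨x, hx⟩
      conv_lhs => rw [e2, map_zpow, ← hs]
      rw [show h x = _ from e3, toAdd_pow, nsmul_eq_mul, zpow_mul, zpow_natCast]
    rw [MonoidHom.mem_ker]
    have := hφ x
    rw [hx'] at this
    exact (right_eq_mul.1 this)
  have : φ.ker.FiniteIndex := finiteIndex_of_le hker
  have : Finite φ.range := Nat.finite_of_card_ne_zero (by
    rw [← index_ker]; exact φ.ker.index_ne_zero_of_finite)
  let r : φ.range →* Module.End ℂ (Fin n → ℂ) :=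
    (Matrix.toLinAlgEquiv'.toMulEquiv.toMonoidHom).comp ((Units.coeHom _).comp φ.range.subtype)
  have hr : Function.Injective r := by
    refine (Matrix.toLinAlgEquiv' (R := ℂ) (n := Fin n)).injective.comp ?_
    exact Units.val_injective.comp φ.range.subtype_injective
  obtain ⟨B, hB, hi⟩ := exists_subgroup_commute_index_le_of_finite r
  refine ⟨B.comap φ.rangeRestrict, ⟨⟨fun a b => Subtype.ext (hι ?_)⟩⟩, ?_⟩
  · have hab : Commute (φ a) (φ b) := by
      have := hB _ a.2 _ b.2
      change _ * _ = _ * _ at this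
      rw [← map_mul, ← map_mul, ← map_mul, ← map_mul] at this
      change φ a * φ b = φ b * φ a
      rw [← map_mul, ← map_mul]
      exact congrArg Subtype.val (hr this)
    have : Commute (ι a) (ι b) := by
      rw [hφ a, hφ b]
      exact (hab.mul_right ((hφs _).zpow_right _)).mul_left
        (((hφs _).symm.zpow_left _).mul_right ((Commute.refl s).zpow_zpow _ _))
    simpa using this.eq
  · rw [index_comap_of_surjective _ φ.rangeRestrict_surjective]
    exact ⟨hi, B.index_ne_zero_of_finite⟩

theorem index_centralizer_le_two_of_mulEquiv_int {M : Type*} [Group M] (Γ : Subgroup M) [Γ.Normal]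
    (e : Γ ≃* Multiplicative ℤ) :
    (centralizer (Γ : Set M)).index ≤ 2 ∧ (centralizer (Γ : Set M)).index ≠ 0 := by
  have hker : (MulAut.conjNormal (H := Γ)).ker = centralizer (Γ : Set M) := by
    ext g
    simp only [MonoidHom.mem_ker, mem_centralizer_iff, SetLike.mem_coe, MulEquiv.ext_iff,
      Subtype.ext_iff, MulAut.conjNormal_apply, MulAut.one_apply, Subtype.forall,
      mul_inv_eq_iff_eq_mul]
    exact forall₂_congr fun _ _ => eq_comm
  have : IsCyclic Γ := isCyclic_of_surjective e.symm e.symm.surjective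
  have hinf : Infinite Γ := e.toEquiv.infinite_iff.2 inferInstance
  have hcard : Nat.card (MulAut Γ) = 2 := by
    rw [Nat.card_congr (IsCyclic.mulAutMulEquiv Γ).toEquiv, Nat.card_eq_zero_of_infinite (α := Γ)]
    change Nat.card ℤˣ = 2
    simp
  have : Finite (MulAut Γ) := Nat.finite_of_card_ne_zero (by omega)
  rw [← hker, index_ker]
  exact ⟨hcard ▸ card_le_card_group _, Nat.card_pos.ne'⟩

theorem theorem3p4 (n : ℕ) :
    ∃ C : ℕ, ∀ (M : Subgroup (Matrix.GeneralLinearGroup (Fin n) ℂ))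
      (Γ : Subgroup M) [Γ.Normal], Γ.FiniteIndex → Nonempty (Γ ≃* Multiplicative ℤ) →
      ∃ c : ℕ, IsLeast {k : ℕ | ∃ A : Subgroup (M ⧸ Γ), IsMulCommutative A ∧ A.index = k} c ∧
        c < C := by
  refine ⟨5 ^ (2 * n ^ 2) * 2 + 1, fun M Γ _ hfin ⟨e⟩ => ?_⟩
  -- The factor 2 in the bound is the index of the centralizer, and `+ 1` makes the inequality
  -- strict.
  obtain ⟨h2, h0⟩ := index_centralizer_le_two_of_mulEquiv_int Γ e
  set Z := centralizer (Γ : Set M)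
  have : IsCyclic Γ := isCyclic_of_surjective e.symm e.symm.surjective
  have hΓZ : Γ ≤ Z := fun x hx y hy => by
    exact congrArg Subtype.val (IsCyclic.isMulCommutative.is_comm.comm (⟨y, hy⟩ : Γ) ⟨x, hx⟩)
  have hcenter : Γ.subgroupOf Z ≤ center Z := fun x hx => mem_center_iff.2 fun g =>
    Subtype.ext (g.2 x hx).symm
  obtain ⟨A, hA, hi, hA0⟩ := exists_isMulCommutative_index_le_of_le_center
    (M.subtype.comp Z.subtype) (M.subtype_injective.comp Z.subtype_injective)
    (Γ.subgroupOf Z) hcenter ((subgroupOfEquivOfLe hΓZ).trans e)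
  let B : Subgroup (M ⧸ Γ) := (A.map Z.subtype).map (QuotientGroup.mk' Γ)
  have hB : IsMulCommutative B := inferInstance
  have hBi : B.index ≤ 5 ^ (2 * n ^ 2) * 2 := by
    refine (Nat.le_of_dvd ?_ (index_map_dvd _ (QuotientGroup.mk'_surjective Γ))).trans ?_
    · rw [index_map_subtype]
      exact Nat.pos_of_ne_zero (mul_ne_zero hA0 h0)
    · rw [index_map_subtype]
      exact Nat.mul_le_mul hi h2
  classical
  have hex : ∃ k : ℕ, ∃ A : Subgroup (M ⧸ Γ), IsMulCommutative A ∧ A.index = k := ⟨_, B, hB, rfl⟩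
  exact ⟨Nat.find hex, ⟨Nat.find_spec hex, fun k hk => Nat.find_min' hex hk⟩,
    Nat.lt_succ_of_le ((Nat.find_min' hex ⟨B, hB, rfl⟩).trans hBi)⟩
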